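/- Let $n$ be a natural number and let $S=(s_{ij})_{i,j=1}^n$ be a real symmetric matrix with nonnegative entries such that $s_{ij}>0$ whenever $i+j\in\{n,n+1\}$ and $s_{ij}=0$ whenever $i+j\ge n+2$. Write $\mathbb H=\{z\in\mathbb C:\operatorname{Im} z>0\}$. Then there is a unique function $m=(m_1,\dots,m_n):\mathbb H\to\mathbb H^n$ satisfying $$-\frac1{m_k(z)}=z+\sum_{j=1}^n s_{kj}\,m_j(z)\qquad\text{for all } z\in\mathbb H,\ k\in\{1,\dots,n\},$$ and there are positive real constants $c_1,\dots,c_n$ (depending only on $S$) such that for every $k\in\{1,\dots,n\}$ $$\lim_{z\to0,\ z\in\mathbb H}\ m_k(z)\,z^{-\left(1-\frac{2k}{n+1}\right)}=c_k\,e^{i\frac{\pi k}{n+1}},$$ where $z^{-\left(1-\frac{2k}{n+1}\right)}$ is defined by the principal branch of the power, i.e. the branch in $\mathbb H$ that extends to positive values at positive $z$. -/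

import Mathlib

open Filter Topology
open scoped UpperHalfPlane

/-- The staircase assumption on a real `n × n` matrix: it is symmetric with nonnegative entries,
and, with rows and columns numbered `1, …, n`, the entry `(i, j)` is positive if `i + j = n` or
`i + j = n + 1` and is zero if `i + j ≥ n + 2`. Elements of `Fin n` are numbered from `0`, so
row `i : Fin n` carries the number `i + 1`. -/
structure IsStaircase {n : ℕ} (S : Matrix (Fin n) (Fin n) ℝ) : Prop where
  symm : S.IsSymm
  nonneg : ∀ i j, 0 ≤ S i j
  pos_above : ∀ i j : Fin n, ((i : ℕ) + 1) + ((j : ℕ) + 1) = n → 0 < S i j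
  pos_anti : ∀ i j : Fin n, ((i : ℕ) + 1) + ((j : ℕ) + 1) = n + 1 → 0 < S i j
  zero_below : ∀ i j : Fin n, n + 2 ≤ ((i : ℕ) + 1) + ((j : ℕ) + 1) → S i j = 0

/-- `m : ℍ → ℍⁿ` solves the vector Dyson equation `-1 / m = z + S m` (entrywise, for all `z`
in the upper half-plane). -/
def IsVDESolution {n : ℕ} (S : Matrix (Fin n) (Fin n) ℝ) (m : ℍ → Fin n → ℍ) : Prop :=
  ∀ (z : ℍ) (k : Fin n), -1 / (m z k : ℂ) = (z : ℂ) + ∑ j, (S k j : ℂ) * (m z j : ℂ)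

/-- The exponent `1 - 2k / (n + 1)` of the `k`-th component, where `k : Fin n` carries the
number `k + 1`. -/
noncomputable def vdeExponent (n : ℕ) (k : Fin n) : ℝ :=
  1 - 2 * ((k : ℝ) + 1) / ((n : ℝ) + 1)

/-!
**Existence and uniqueness.** For fixed `z` the map `w ↦ -1 / (z + S w)` strictly decreases the
supremum of the hyperbolic distances on `ℍⁿ` (`dist_dysonMap_lt`) and leaves a compact set
invariant, so it has exactly one fixed point (`existsUnique_dysonMap_eq`).

**Asymptotics.** Number the components `1, …, n`, put `m 0 = z`, and border `S` by ones to a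
matrix `T` indexed from `0`. The equations become `-1 = ∑ j, T k j * m k * m j` for `1 ≤ k ≤ n`,
where only `j ≤ n + 1 - k` contribute. Put `ζ = e^(-iπ/(n+1)) * z^(2/(n+1))`, so that
`ζ ^ (n + 1) = -z ^ 2`, and substitute `m k = c k * z * ζ ^ (-k) * u k`. With
`a k j = T k j * c k * c j` this gives
`1 = ∑ j, a k j * ζ ^ (n + 1 - k - j) * u k * u j`, a system that is polynomial in `ζ`. The constants
`c` are chosen (`IsStaircase.exists_scaling`) such that `a` is `1` on `k + j = n + 1` and constant on
`k + j = n`. Then `u = 1` solves the system at `ζ = 0` to the order that matters: the equations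
numbered `k` and `n + 1 - k` have the same leading term `u k * u (n + 1 - k)`, and after replacing
one of each pair by the difference divided by `ζ` the linearization at `u = 1` is invertible
(`eq_zero_of_linearized`). By the inverse function theorem there is a solution `u` near `1` for
every small `ζ` (`eventually_exists_scaled_solution`).

The argument of `z * ζ ^ (-k)` stays between `π / (n + 1)` and `π - π / (n + 1)` for all `z ∈ ℍ`, so
the resulting `m k` lie in `ℍ` for all small `z` (`im_mul_inv_smallParam_pow_mul_pos`). By uniqueness
they are the solution, and `z * ζ ^ (-k) = e^(iπk/(n+1)) * z^(1 - 2k/(n+1))`.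
-/

/-! ### Pointwise solution of the Dyson equation -/

/-- A self-map that strictly decreases distances and leaves some nonempty compact set invariant
has a fixed point, namely any minimizer of the displacement `dist x (f x)` on that set. -/
lemma exists_fixedPoint_of_dist_map_lt {X : Type*} [MetricSpace X] {f : X → X}
    (hf : ∀ x y, x ≠ y → dist (f x) (f y) < dist x y) {K : Set X} (hK : IsCompact K)
    (hne : K.Nonempty) (hmaps : Set.MapsTo f K K) : ∃ x, f x = x := by
  have hcont : Continuous f := by
    refine (LipschitzWith.of_dist_le_mul (K := 1) fun x y => ?_).continuous
    rcases eq_or_ne x y with rfl | h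
    · simp
    · simpa using (hf x y h).le
  obtain ⟨x, hxK, hx⟩ := hK.exists_isMinOn hne (f := fun x => dist x (f x))
    (by fun_prop)
  refine ⟨x, by_contra fun h => ?_⟩
  exact absurd (hx (hmaps hxK)) (not_le.2 (hf x (f x) (Ne.symm h)))

/-- The affine part `w ↦ z + ∑ j, a j * w j` of the Dyson map. -/
noncomputable def affineMap {n : ℕ} (a : Fin n → ℝ) (ha : ∀ j, 0 ≤ a j) (z : ℍ) (w : Fin n → ℍ) :
    ℍ :=
  ⟨(z : ℂ) + ∑ j, (a j : ℂ) * (w j : ℂ), by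
    have : 0 ≤ ∑ j, a j * (w j).im :=
      Finset.sum_nonneg fun j _ => mul_nonneg (ha j) (w j).im_pos.le
    simpa using add_pos_of_pos_of_nonneg z.im_pos this⟩

lemma affineMap_im {n : ℕ} (a : Fin n → ℝ) (ha : ∀ j, 0 ≤ a j) (z : ℍ) (w : Fin n → ℍ) :
    (affineMap a ha z w).im = z.im + ∑ j, a j * (w j).im := by
  simp [affineMap]

/-- By the Cauchy–Schwarz inequality the sum `∑ j, a j * w j` does not increase the supremum
distance, and translation by `z` upwards strictly decreases it. -/
lemma dist_affineMap_lt {n : ℕ} (a : Fin n → ℝ) (ha : ∀ j, 0 ≤ a j) (z : ℍ) {v w : Fin n → ℍ}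
    (hvw : v ≠ w) : dist (affineMap a ha z v) (affineMap a ha z w) < dist v w := by
  set r := dist v w with hr
  have hr0 : 0 < r := dist_pos.2 hvw
  set κ := 2 * (Real.cosh r - 1) with hκ
  have hκ0 : 0 < κ := by have := Real.one_lt_cosh.2 hr0.ne'; linarith
  have hj : ∀ j, dist (v j : ℂ) (w j) ^ 2 ≤ κ * ((v j).im * (w j).im) := fun j => by
    have h1 : Real.cosh (dist (v j) (w j)) ≤ Real.cosh r := by
      rw [Real.cosh_le_cosh, abs_of_nonneg dist_nonneg, abs_of_pos hr0]
      exact dist_le_pi_dist v w j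
    rw [UpperHalfPlane.cosh_dist] at h1
    have hp : 0 < 2 * (v j).im * (w j).im := by have := (v j).im_pos; have := (w j).im_pos; positivity
    have h2 := (div_le_iff₀ hp).1 (le_sub_iff_add_le'.2 h1)
    rw [hκ]; linarith
  set A := ∑ j, a j * (v j).im with hA
  set B := ∑ j, a j * (w j).im with hB
  have hA0 : 0 ≤ A := Finset.sum_nonneg fun j _ => mul_nonneg (ha j) (v j).im_pos.le
  have hB0 : 0 ≤ B := Finset.sum_nonneg fun j _ => mul_nonneg (ha j) (w j).im_pos.le
  have hd : dist (affineMap a ha z v : ℂ) (affineMap a ha z w) ≤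
      ∑ j, a j * dist (v j : ℂ) (w j) := by
    have : (affineMap a ha z v : ℂ) - affineMap a ha z w =
        ∑ j, (a j : ℂ) * ((v j : ℂ) - w j) := by
      simp [affineMap, mul_sub, Finset.sum_sub_distrib]
    rw [dist_eq_norm, this]
    refine (norm_sum_le _ _).trans_eq (Finset.sum_congr rfl fun j _ => ?_)
    rw [norm_mul, Complex.norm_real, Real.norm_of_nonneg (ha j), dist_eq_norm]
  have hCS : (∑ j, a j * dist (v j : ℂ) (w j)) ^ 2 ≤
      (∑ j, κ * (a j * (v j).im)) * ∑ j, a j * (w j).im := by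
    refine Finset.sum_sq_le_sum_mul_sum_of_sq_le_mul _ (fun j _ => ?_) (fun j _ => ?_) fun j _ => ?_
    · have := ha j; have := (v j).im_pos; positivity
    · have := ha j; have := (w j).im_pos; positivity
    · have := mul_le_mul_of_nonneg_left (hj j) (sq_nonneg (a j))
      linarith
  rw [← Finset.mul_sum, ← hA, ← hB] at hCS
  have hz := z.im_pos
  have hlt : dist (affineMap a ha z v : ℂ) (affineMap a ha z w) ^ 2 <
      κ * ((z.im + A) * (z.im + B)) := by
    refine ((pow_le_pow_left₀ dist_nonneg hd 2).trans hCS).trans_lt ?_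
    rw [mul_assoc]
    refine mul_lt_mul_of_pos_left ?_ hκ0
    nlinarith [mul_pos hz hz, mul_nonneg hz.le hA0, mul_nonneg hz.le hB0]
  have hcosh : Real.cosh (dist (affineMap a ha z v) (affineMap a ha z w)) < Real.cosh r := by
    rw [UpperHalfPlane.cosh_dist, affineMap_im, affineMap_im, ← hA, ← hB, ← lt_sub_iff_add_lt',
      div_lt_iff₀ (by positivity)]
    rw [hκ] at hlt; linarith
  rwa [Real.cosh_lt_cosh, abs_of_nonneg dist_nonneg, abs_of_pos hr0] at hcosh

/-- The Dyson map `w ↦ -1 / (z + S w)` on `ℍⁿ`. The inversion `w ↦ -1 / w` is written as the action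
of `ModularGroup.S`, which is an isometry of the hyperbolic plane. -/
noncomputable def dysonMap {n : ℕ} (S : Matrix (Fin n) (Fin n) ℝ) (hS : ∀ i j, 0 ≤ S i j) (z : ℍ)
    (w : Fin n → ℍ) : Fin n → ℍ :=
  fun k => ModularGroup.S • affineMap (S k) (hS k) z w

lemma coe_dysonMap {n : ℕ} (S : Matrix (Fin n) (Fin n) ℝ) (hS : ∀ i j, 0 ≤ S i j) (z : ℍ)
    (w : Fin n → ℍ) (k : Fin n) :
    (dysonMap S hS z w k : ℂ) = (-(affineMap (S k) (hS k) z w : ℂ))⁻¹ := by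
  rw [dysonMap, UpperHalfPlane.modular_S_smul]

lemma dist_dysonMap_lt {n : ℕ} (S : Matrix (Fin n) (Fin n) ℝ) (hS : ∀ i j, 0 ≤ S i j) (z : ℍ)
    {v w : Fin n → ℍ} (hvw : v ≠ w) : dist (dysonMap S hS z v) (dysonMap S hS z w) < dist v w := by
  rw [dist_pi_lt_iff (dist_pos.2 hvw)]
  intro k
  have : dist (dysonMap S hS z v k) (dysonMap S hS z w k) =
      dist (affineMap (S k) (hS k) z v) (affineMap (S k) (hS k) z w) :=
    dist_smul (Matrix.SpecialLinearGroup.map (Int.castRingHom ℝ) ModularGroup.S) _ _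
  rw [this]
  exact dist_affineMap_lt _ _ _ hvw

lemma dysonMap_eq_iff {n : ℕ} (S : Matrix (Fin n) (Fin n) ℝ) (hS : ∀ i j, 0 ≤ S i j) (z : ℍ)
    (w : Fin n → ℍ) : dysonMap S hS z w = w ↔
      ∀ k, -1 / (w k : ℂ) = (z : ℂ) + ∑ j, (S k j : ℂ) * (w j : ℂ) := by
  rw [funext_iff]
  refine forall_congr' fun k => ?_
  rw [← UpperHalfPlane.coe_inj, coe_dysonMap]
  change _ ↔ -1 / (w k : ℂ) = (affineMap (S k) (hS k) z w : ℂ)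
  have h1 := (affineMap (S k) (hS k) z w).ne_zero
  have h2 := (w k).ne_zero
  rw [div_eq_iff h2, inv_eq_iff_eq_inv, eq_comm, inv_eq_iff_eq_inv, ← neg_inv,
    eq_neg_iff_add_eq_zero, ← mul_left_inj' h1, add_mul, inv_mul_cancel₀ h1, zero_mul,
    eq_comm (a := (-1 : ℂ)), ← add_eq_zero_iff_eq_neg, mul_comm]

lemma isCompact_setOf_norm_le_le_im (R δ : ℝ) (hδ : 0 < δ) :
    IsCompact {w : ℍ | ‖(w : ℂ)‖ ≤ R ∧ δ ≤ w.im} := by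
  have hK : IsCompact (Metric.closedBall (0 : ℂ) R ∩ {w | δ ≤ w.im}) :=
    (isCompact_closedBall 0 R).inter_right (isClosed_le continuous_const Complex.continuous_im)
  have := (UpperHalfPlane.isEmbedding_coe.isInducing.isCompact_preimage_iff
    (K := Metric.closedBall (0 : ℂ) R ∩ {w | δ ≤ w.im})
    (fun w hw => ⟨⟨w, hδ.trans_le hw.2⟩, rfl⟩)).2 hK
  convert this using 1
  ext w
  simp

/-- For each `z ∈ ℍ` the Dyson equation has exactly one solution in `ℍⁿ`. -/
lemma existsUnique_dysonMap_eq {n : ℕ} (S : Matrix (Fin n) (Fin n) ℝ) (hS : ∀ i j, 0 ≤ S i j)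
    (z : ℍ) : ∃! w : Fin n → ℍ, dysonMap S hS z w = w := by
  refine existsUnique_of_exists_of_unique ?_ fun v w hv hw => ?_
  · have hz := z.im_pos
    set C := ∑ i, ∑ j, S i j with hC
    have hC0 : 0 ≤ C := Finset.sum_nonneg fun i _ => Finset.sum_nonneg fun j _ => hS i j
    set R := z.im⁻¹ with hR
    have hR0 : 0 < R := inv_pos.2 hz
    set M := ‖(z : ℂ)‖ + C * R with hM
    have hM0 : 0 < M := add_pos_of_pos_of_nonneg (norm_pos_iff.2 z.ne_zero) (by positivity)
    set δ := z.im / M ^ 2 with hδ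
    have him : ∀ w k, z.im ≤ (affineMap (S k) (hS k) z w).im := fun w k => by
      rw [affineMap_im]
      exact le_add_of_nonneg_right
        (Finset.sum_nonneg fun j _ => mul_nonneg (hS k j) (w j).im_pos.le)
    have hnorm : ∀ w k, ‖(dysonMap S hS z w k : ℂ)‖ ≤ R := fun w k => by
      rw [coe_dysonMap, norm_inv, norm_neg, hR]
      exact inv_anti₀ hz ((him w k).trans ((le_abs_self _).trans (Complex.abs_im_le_norm _)))
    have hδle : ∀ w : Fin n → ℍ, (∀ j, ‖(w j : ℂ)‖ ≤ R) → ∀ k, δ ≤ (dysonMap S hS z w k).im :=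
      fun w hw k => by
        have h1 : ‖(affineMap (S k) (hS k) z w : ℂ)‖ ≤ M := by
          refine (norm_add_le _ _).trans (add_le_add_right ?_ _)
          refine (norm_sum_le _ _).trans ?_
          have : ∑ j, S k j ≤ C :=
            Finset.single_le_sum (f := fun i => ∑ j, S i j)
              (fun i _ => Finset.sum_nonneg fun j _ => hS i j) (Finset.mem_univ k)
          refine le_trans ?_ (mul_le_mul_of_nonneg_right this hR0.le)
          rw [Finset.sum_mul]
          refine Finset.sum_le_sum fun j _ => ?_
          rw [norm_mul, Complex.norm_real, Real.norm_of_nonneg (hS k j)]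
          exact mul_le_mul_of_nonneg_left (hw j) (hS k j)
        have h2 : (dysonMap S hS z w k).im =
            (affineMap (S k) (hS k) z w).im / ‖(affineMap (S k) (hS k) z w : ℂ)‖ ^ 2 := by
          rw [← UpperHalfPlane.coe_im, coe_dysonMap, Complex.inv_im, Complex.normSq_eq_norm_sq]
          simp
        rw [h2, hδ]
        have h3 := norm_pos_iff.2 (affineMap (S k) (hS k) z w).ne_zero
        have h4 := him w k
        gcongr
    refine exists_fixedPoint_of_dist_map_lt (fun v w => dist_dysonMap_lt S hS z)
      (K := {w | ∀ k, w k ∈ {w : ℍ | ‖(w : ℂ)‖ ≤ R ∧ δ ≤ w.im}}) ?_ ?_ ?_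
    · exact isCompact_pi_infinite fun _ => isCompact_setOf_norm_le_le_im R δ (by positivity)
    · let w₀ : Fin n → ℍ := fun _ => UpperHalfPlane.I
      exact ⟨_, fun k => ⟨hnorm (dysonMap S hS z w₀) k, hδle _ (fun j => hnorm w₀ j) k⟩⟩
    · exact fun w hw k => ⟨hnorm w k, hδle w (fun j => (hw j).1) k⟩
  · by_contra h
    have := dist_dysonMap_lt S hS z h
    rw [hv, hw] at this
    exact lt_irrefl _ this

lemma existsUnique_isVDESolution {n : ℕ} (S : Matrix (Fin n) (Fin n) ℝ) (hS : ∀ i j, 0 ≤ S i j) :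
    ∃! m : ℍ → Fin n → ℍ, IsVDESolution S m := by
  choose m hm huniq using existsUnique_dysonMap_eq S hS
  exact ⟨m, fun z => (dysonMap_eq_iff S hS z _).1 (hm z),
    fun m' h' => funext fun z => huniq z _ ((dysonMap_eq_iff S hS z _).2 (h' z))⟩

/-! ### The limiting constants -/

/-- The matrix `S` with rows and columns numbered `1, …, n`, bordered by a row and a column of ones
numbered `0`. It turns the Dyson equation into `-1 = ∑ j, T k j * m k * m j` for `1 ≤ k ≤ n`,
with `m 0 = z`. Entries outside the matrix are zero off the border, in line with the staircase
condition. -/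
def bordered {n : ℕ} (S : Matrix (Fin n) (Fin n) ℝ) : ℕ → ℕ → ℝ
  | 0, _ => 1
  | _ + 1, 0 => 1
  | i + 1, j + 1 => if h : i < n ∧ j < n then S ⟨i, h.1⟩ ⟨j, h.2⟩ else 0

/-- Additive form of the scaling problem: the two families of equations determine the increments
`l (k + 1) - l k = p k - q k - τ`, and `τ` is fixed by the equation `l 0 + l n = τ + q 0`. -/
lemma exists_add_reflect_eq (n : ℕ) (p q : ℕ → ℝ) (hp : ∀ i j, i + j + 1 = n → p i = p j)
    (hq : ∀ i j, i + j = n → q i = q j) :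
    ∃ (τ : ℝ) (l : ℕ → ℝ), l 0 = 0 ∧ (∀ i j, i + j + 1 = n → l (i + 1) + l (j + 1) = p i) ∧
      ∀ i j, i + j = n → l i + l j = τ + q i := by
  set τ : ℝ := (∑ i ∈ Finset.range n, (p i - q i) - q 0) / (n + 1) with hτ
  set l : ℕ → ℝ := fun k => ∑ i ∈ Finset.range k, (p i - q i) - k * τ with hl
  have hl0 : l 0 = 0 := by simp [hl]
  have hstep : ∀ k, l (k + 1) = l k + (p k - q k - τ) := fun k => by
    simp only [hl, Finset.sum_range_succ]; push_cast; ring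
  have h2 : ∀ i j, i + j = n → l i + l j = τ + q i := by
    intro i
    induction i with
    | zero =>
      intro j hj
      obtain rfl : j = n := by omega
      have hn : (j : ℝ) + 1 ≠ 0 := by positivity
      have : τ * (j + 1) = ∑ i ∈ Finset.range j, (p i - q i) - q 0 := by
        rw [hτ, div_mul_cancel₀ _ hn]
      rw [hl0]; simp only [hl]; linarith
    | succ i ih =>
      intro j hj
      have h1 := ih (j + 1) (by omega)
      have h3 := hp i j (by omega)
      have h4 := hq (i + 1) j hj
      have h5 := hstep i
      have h6 := hstep j
      linarith
  refine ⟨τ, l, hl0, fun i j hij => ?_, h2⟩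
  have h1 := h2 i (j + 1) (by omega)
  have h3 := hstep i
  linarith

/-- The constants `c k` of the asymptotics. They make the two extreme antidiagonals of the scaled
bordered matrix `T i j * c i * c j` constant, equal to `1` and to `t` respectively. -/
lemma IsStaircase.exists_scaling {n : ℕ} {S : Matrix (Fin n) (Fin n) ℝ} (hS : IsStaircase S) :
    ∃ (t : ℝ) (c : ℕ → ℝ), 0 < t ∧ c 0 = 1 ∧ (∀ k, 0 < c k) ∧
      (∀ i j, i + j + 1 = n → bordered S (i + 1) (j + 1) * (c (i + 1) * c (j + 1)) = 1) ∧
      ∀ i j, i + j = n → bordered S i j * (c i * c j) = t := by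
  have hsymm : ∀ i j, bordered S i j = bordered S j i := by
    intro i j
    rcases i with - | i <;> rcases j with - | j <;> simp only [bordered]
    by_cases h : i < n ∧ j < n
    · rw [dif_pos h, dif_pos h.symm, hS.symm.apply]
    · rw [dif_neg h, dif_neg (fun h' => h h'.symm)]
  have hpos1 : ∀ i j, i + j + 1 = n → 0 < bordered S (i + 1) (j + 1) := fun i j h => by
    rw [bordered, dif_pos ⟨by omega, by omega⟩]
    exact hS.pos_anti _ _ (by simp only; omega)
  have hpos2 : ∀ i j, i + j = n → 0 < bordered S i j := fun i j h => by
    rcases i with - | i <;> rcases j with - | j <;> simp only [bordered, zero_lt_one]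
    rw [dif_pos ⟨by omega, by omega⟩]
    exact hS.pos_above _ _ (by simp only; omega)
  obtain ⟨τ, l, hl0, hl1, hl2⟩ := exists_add_reflect_eq n
    (fun i => -Real.log (bordered S (i + 1) (n - i)))
    (fun i => -Real.log (bordered S i (n - i))) (fun i j h => by
      have h1 : n - i = j + 1 := by omega
      have h2 : n - j = i + 1 := by omega
      simp only [h1, h2, hsymm (i + 1)]) (fun i j h => by
      have h1 : n - i = j := by omega
      have h2 : n - j = i := by omega
      simp only [h1, h2, hsymm i])
  refine ⟨Real.exp τ, fun k => Real.exp (l k), Real.exp_pos _, by simp [hl0],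
    fun k => Real.exp_pos _, fun i j h => ?_, fun i j h => ?_⟩
  · have h1 : n - i = j + 1 := by omega
    rw [← Real.exp_add, hl1 i j h, h1, Real.exp_neg, Real.exp_log (hpos1 i j h),
      mul_inv_cancel₀ (hpos1 i j h).ne']
  · have h1 : n - i = j := by omega
    rw [← Real.exp_add, hl2 i j h, h1, Real.exp_add, Real.exp_neg, Real.exp_log (hpos2 i j h)]
    have := (hpos2 i j h).ne'
    field_simp

/-! ### The desingularized system -/

/-- A vector `u 1, …, u n` extended by `u 0 = 1` (and by zero beyond `n`). -/
def extendOne {n : ℕ} (u : Fin n → ℂ) : ℕ → ℂ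
  | 0 => 1
  | k + 1 => if h : k < n then u ⟨k, h⟩ else 0

/-- The part of the `(k + 1)`-st scaled equation carrying a factor `ζ`, divided by `ζ`. -/
noncomputable def remainderTerm (n : ℕ) (a : ℕ → ℕ → ℂ) (ζ : ℂ) (u : ℕ → ℂ) (k : ℕ) : ℂ :=
  u (k + 1) * ∑ j ∈ Finset.range (n - k), a (k + 1) j * ζ ^ (n - k - 1 - j) * u j

/-- The scaled equations `u (k + 1) * u (n - k) + ζ * R k = 1`, rearranged so that they stay
independent at `ζ = 0`. At `ζ = 0` the equations numbered `k` and `n - 1 - k` coincide; since their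
first terms agree for every `ζ`, one of them is replaced by `R k = R (n - 1 - k)`. -/
noncomputable def scaledSystem {n : ℕ} (a : ℕ → ℕ → ℂ) (p : ℂ × (Fin n → ℂ)) (k : Fin n) : ℂ :=
  if 2 * (k : ℕ) + 1 ≤ n then
    extendOne p.2 (k + 1) * extendOne p.2 (n - k) + p.1 * remainderTerm n a p.1 (extendOne p.2) k - 1
  else
    remainderTerm n a p.1 (extendOne p.2) k - remainderTerm n a p.1 (extendOne p.2) (n - 1 - k)

lemma contDiff_scaledSystem {n : ℕ} (a : ℕ → ℕ → ℂ) :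
    ContDiff ℂ 1 (scaledSystem a : ℂ × (Fin n → ℂ) → Fin n → ℂ) := by
  have hext : ∀ k, ContDiff ℂ 1 fun p : ℂ × (Fin n → ℂ) => extendOne p.2 k := by
    intro k
    rcases k with - | k
    · exact contDiff_const
    · by_cases h : k < n
      · simp only [extendOne, dif_pos h]
        fun_prop
      · simp only [extendOne, dif_neg h]
        fun_prop
  have hrem : ∀ k, ContDiff ℂ 1 fun p : ℂ × (Fin n → ℂ) =>
      remainderTerm n a p.1 (extendOne p.2) k := by
    intro k
    unfold remainderTerm
    fun_prop
  rw [contDiff_pi]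
  intro k
  unfold scaledSystem
  by_cases h : 2 * (k : ℕ) + 1 ≤ n
  · simp only [if_pos h]
    fun_prop
  · simp only [if_neg h]
    fun_prop

lemma remainderTerm_zero {n : ℕ} (a : ℕ → ℕ → ℂ) (u : ℕ → ℂ) {k : ℕ} (hk : k < n) :
    remainderTerm n a 0 u k = a (k + 1) (n - k - 1) * (u (k + 1) * u (n - k - 1)) := by
  rw [remainderTerm, Finset.sum_eq_single_of_mem (n - k - 1) (by simp; omega)]
  · simp; ring
  · intro j hj hne
    rw [zero_pow (by simp at hj; omega)]
    ring

/-- The linearization at `ζ = 0`, `u = 1` of the scaled equations has trivial kernel: they force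
`w k = -k * w n` and then `(n + 1) * w n = 0`. -/
lemma eq_zero_of_linearized {n : ℕ} {w : ℕ → ℂ} (h0 : w 0 = 0)
    (h1 : ∀ k, 2 * k + 1 ≤ n → w (k + 1) + w (n - k) = 0)
    (h2 : ∀ k, k < n → n < 2 * k + 1 → w (k + 1) + w (n - k - 1) = w (n - k) + w k) :
    ∀ k ≤ n, w k = 0 := by
  have h1' : ∀ k, k < n → w (k + 1) + w (n - k) = 0 := fun k hk => by
    rcases le_or_gt (2 * k + 1) n with h | h
    · exact h1 k h
    · have := h1 (n - 1 - k) (by omega)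
      rwa [show n - 1 - k + 1 = n - k by omega, show n - (n - 1 - k) = k + 1 by omega,
        add_comm] at this
  have h2' : ∀ k, k < n → w (k + 1) + w (n - k - 1) = w (n - k) + w k := fun k hk => by
    rcases lt_trichotomy (2 * k + 1) n with h | h | h
    · have := h2 (n - 1 - k) (by omega) (by omega)
      rw [show n - 1 - k + 1 = n - k by omega, show n - (n - 1 - k) - 1 = k by omega,
        show n - (n - 1 - k) = k + 1 by omega, show n - 1 - k = n - k - 1 by omega] at this
      exact this.symm
    · rw [show n - k - 1 = k by omega, show n - k = k + 1 by omega]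
    · exact h2 k hk h
  have hV : ∀ k ≤ n, w k + w (n - k) = w n := fun k => by
    induction k with
    | zero => intro _; simp [h0]
    | succ k ih =>
      intro hk
      rw [← ih (by omega), ← Nat.sub_sub, h2' k hk, add_comm]
  -- Combine `w (k + 1) + w (n - k) = 0` with `w k + w (n - k) = w n`.
  have hlin : ∀ k ≤ n, w k = -(k : ℂ) * w n := fun k => by
    induction k with
    | zero => intro _; simp [h0]
    | succ k ih =>
      intro hk
      have e1 := ih (by omega)
      have e2 := hV k (by omega)
      have e3 := h1' k hk
      push_cast
      linear_combination e3 - e2 + e1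
  have hn : w n = 0 := by
    have e := hlin n le_rfl
    have : ((n : ℂ) + 1) * w n = 0 := by linear_combination e
    exact (mul_eq_zero.1 this).resolve_left (Nat.cast_add_one_ne_zero n)
  intro k hk
  rw [hlin k hk, hn, mul_zero]

/-- Along the line `1 + s * v` every entry of `extendOne` is affine in `s`, with slopes `w` that are
`v` extended by `w 0 = 0`. -/
lemma extendOne_one_add {n : ℕ} (v : Fin n → ℂ) : ∃ w : ℕ → ℂ, w 0 = 0 ∧
    (∀ k : Fin n, w (k + 1) = v k) ∧
    ∀ (s : ℂ), ∀ k ≤ n, extendOne (fun i => 1 + s * v i) k = 1 + s * w k := by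
  refine ⟨fun k => extendOne v k - if k = 0 then 1 else 0, by simp [extendOne],
    fun k => by simp [extendOne], fun s k hk => ?_⟩
  rcases k with - | k
  · simp [extendOne]
  · simp [extendOne, show k < n by omega]

lemma scaledSystem_fderiv_injective {n : ℕ} {a : ℕ → ℕ → ℂ} {t : ℂ} (ht : t ≠ 0)
    (ha : ∀ i j, i + j = n → a i j = t) (v : Fin n → ℂ)
    (hv : fderiv ℂ (scaledSystem a) ((0 : ℂ), fun _ : Fin n => (1 : ℂ)) (0, v) = 0) : v = 0 := by
  obtain ⟨w, hw0, hwv, hw⟩ := extendOne_one_add v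
  have hline : HasDerivAt (fun s : ℂ => ((0 : ℂ), fun i : Fin n => 1 + s * v i)) (0, v) 0 := by
    refine (hasDerivAt_const _ _).prodMk (hasDerivAt_pi.2 fun i => ?_)
    simpa using ((hasDerivAt_id (0 : ℂ)).mul_const (v i)).const_add 1
  have hdiff : HasFDerivAt (scaledSystem a)
      (fderiv ℂ (scaledSystem a) ((0 : ℂ), fun _ : Fin n => (1 : ℂ)))
      ((fun s : ℂ => ((0 : ℂ), fun i : Fin n => 1 + s * v i)) 0) := by
    simpa using ((contDiff_scaledSystem a).differentiable one_ne_zero _).hasFDerivAt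
  have hcomp := hasDerivAt_pi.1 (hdiff.comp_hasDerivAt 0 hline)
  have hlin : ∀ x y : ℂ, HasDerivAt (fun s : ℂ => (1 + s * x) * (1 + s * y)) (x + y) 0 := by
    intro x y
    have := (((hasDerivAt_id (0 : ℂ)).mul_const x).const_add 1).mul
      (((hasDerivAt_id (0 : ℂ)).mul_const y).const_add 1)
    exact (this.congr_deriv (by simp)).congr_of_eventuallyEq
      (Eventually.of_forall fun s => by simp)
  have hker := eq_zero_of_linearized (n := n) hw0 (fun k hk => ?_) (fun k hk hk' => ?_)
  · funext k
    rw [← hwv k]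
    exact hker _ (by omega)
  · have hk' : k < n := by omega
    have h1 := hcomp ⟨k, hk'⟩
    have h2 : HasDerivAt (fun s : ℂ => (1 + s * w (k + 1)) * (1 + s * w (n - k)) - 1)
      (w (k + 1) + w (n - k)) 0 := (hlin _ _).sub_const 1
    rw [hv] at h1
    refine h2.unique (h1.congr_of_eventuallyEq (Eventually.of_forall fun s => ?_))
    simp [scaledSystem, hk, hw s (k + 1) hk', hw s (n - k) (by omega)]
  · have h1 := hcomp ⟨k, hk⟩
    have h2 : HasDerivAt (fun s : ℂ => t * ((1 + s * w (k + 1)) * (1 + s * w (n - k - 1))) -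
        t * ((1 + s * w (n - k)) * (1 + s * w k)))
      (t * (w (k + 1) + w (n - k - 1)) - t * (w (n - k) + w k)) 0 :=
      ((hlin _ _).const_mul t).sub ((hlin _ _).const_mul t)
    rw [hv] at h1
    have h3 := h2.unique (h1.congr_of_eventuallyEq (f₁ := fun s : ℂ =>
        t * ((1 + s * w (k + 1)) * (1 + s * w (n - k - 1))) -
        t * ((1 + s * w (n - k)) * (1 + s * w k))) (Eventually.of_forall fun s => ?_))
    · exact mul_left_cancel₀ ht (sub_eq_zero.1 h3)
    · simp only [scaledSystem, Function.comp, if_neg (not_le.2 hk')]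
      rw [remainderTerm_zero _ _ hk, remainderTerm_zero _ _ (by omega),
        show n - 1 - k + 1 = n - k by omega, show n - (n - 1 - k) - 1 = k by omega,
        ha _ _ (by omega), ha _ _ (by omega), hw s _ (by omega), hw s _ (by omega),
        hw s _ (by omega), hw s _ (by omega)]

/-- For `ζ` close to `0` the scaled equations have a solution close to `1`. The inverse function
theorem for `(ζ, u) ↦ (ζ, scaledSystem a (ζ, u))` gives a solution of the rearranged system, which
also solves the original one. -/
lemma eventually_exists_scaled_solution {n : ℕ} {a : ℕ → ℕ → ℂ} {t : ℂ} (ht : t ≠ 0)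
    (ha1 : ∀ i j, i + j + 1 = n → a (i + 1) (j + 1) = 1) (ha : ∀ i j, i + j = n → a i j = t)
    {ε : ℝ} (hε : 0 < ε) :
    ∀ᶠ ζ : ℂ in 𝓝 0, ∃ u : ℕ → ℂ, u 0 = 1 ∧ (∀ k, k < n → ‖u (k + 1) - 1‖ < ε) ∧
      ∀ k, k < n →
        ∑ j ∈ Finset.range (n - k + 1), a (k + 1) j * ζ ^ (n - k - j) * (u (k + 1) * u j) = 1 := by
  set p₀ : ℂ × (Fin n → ℂ) := (0, fun _ => 1) with hp₀
  set Φ : ℂ × (Fin n → ℂ) → ℂ × (Fin n → ℂ) := fun p => (p.1, scaledSystem a p) with hΦ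
  have hstrict : HasStrictFDerivAt Φ
      ((ContinuousLinearMap.fst ℂ ℂ (Fin n → ℂ)).prod (fderiv ℂ (scaledSystem a) p₀)) p₀ :=
    hasStrictFDerivAt_fst.prodMk ((contDiff_scaledSystem a).contDiffAt.hasStrictFDerivAt one_ne_zero)
  have hinj : Function.Injective
      ((ContinuousLinearMap.fst ℂ ℂ (Fin n → ℂ)).prod (fderiv ℂ (scaledSystem a) p₀)) := by
    rw [injective_iff_map_eq_zero]
    rintro ⟨x, v⟩ h
    obtain rfl : x = 0 := congrArg Prod.fst h
    rw [scaledSystem_fderiv_injective ht ha v (congrArg Prod.snd h)]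
    rfl
  have hsurj := LinearMap.range_eq_top.2 (LinearMap.surjective_of_injective
    (f := ((ContinuousLinearMap.fst ℂ ℂ (Fin n → ℂ)).prod (fderiv ℂ (scaledSystem a) p₀) :
      ℂ × (Fin n → ℂ) →ₗ[ℂ] ℂ × (Fin n → ℂ))) hinj)
  have hmap := hstrict.map_nhds_eq_of_surj hsurj
  have hone : ∀ k ≤ n, extendOne (fun _ : Fin n => (1 : ℂ)) k = 1 := by
    rintro (- | k) hk
    · rfl
    · simp [extendOne, show k < n by omega]
  have hΦ0 : Φ p₀ = 0 := by
    refine Prod.ext rfl (funext fun k => ?_)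
    have hk := k.2
    simp only [hΦ, scaledSystem, hp₀]
    split_ifs with h
    · simp [hone (k + 1) hk, hone (n - k) (by omega)]
    · rw [remainderTerm_zero _ _ hk, remainderTerm_zero _ _ (by omega),
        show n - 1 - (k : ℕ) + 1 = n - k by omega, show n - (n - 1 - (k : ℕ)) - 1 = k by omega,
        ha _ _ (by omega), ha _ _ (by omega), hone _ (by omega), hone _ (by omega),
        hone _ (by omega), hone _ (by omega)]
      simp
  have hU : {p : ℂ × (Fin n → ℂ) | dist p p₀ < ε} ∈ 𝓝 p₀ := Metric.ball_mem_nhds p₀ hε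
  have himg := Filter.image_mem_map (m := Φ) hU
  rw [hmap, hΦ0] at himg
  have hcont : Tendsto (fun ζ : ℂ => (ζ, (0 : Fin n → ℂ))) (𝓝 0) (𝓝 0) :=
    (Continuous.prodMk_left (0 : Fin n → ℂ)).tendsto 0
  filter_upwards [hcont himg] with ζ hζ
  obtain ⟨⟨ζ', u⟩, hu, huζ⟩ := hζ
  obtain rfl : ζ' = ζ := congrArg Prod.fst huζ
  have hG : ∀ k, scaledSystem a (ζ', u) k = 0 := fun k => congrFun (congrArg Prod.snd huζ) k
  set x := extendOne u with hx
  -- The first half of the rearranged equations, and then the other half by symmetry.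
  have hA : ∀ k, 2 * k + 1 ≤ n → x (k + 1) * x (n - k) + ζ' * remainderTerm n a ζ' x k = 1 :=
    fun k hk => by
      have := hG ⟨k, by omega⟩
      simp only [scaledSystem, if_pos hk] at this
      exact sub_eq_zero.1 this
  have hB : ∀ k, k < n → x (k + 1) * x (n - k) + ζ' * remainderTerm n a ζ' x k = 1 := by
    intro k hk
    rcases le_or_gt (2 * k + 1) n with h | h
    · exact hA k h
    · have h1 := hG ⟨k, hk⟩
      simp only [scaledSystem, if_neg (not_le.2 h)] at h1
      have h2 := hA (n - 1 - k) (by omega)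
      rw [show n - 1 - k + 1 = n - k by omega, show n - (n - 1 - k) = k + 1 by omega] at h2
      linear_combination h2 + ζ' * h1
  refine ⟨x, rfl, fun k hk => ?_, fun k hk => ?_⟩
  · have h1 : x (k + 1) = u ⟨k, hk⟩ := by simp [hx, extendOne, hk]
    rw [h1, ← dist_eq_norm]
    exact (dist_le_pi_dist u (fun _ => 1) ⟨k, hk⟩).trans_lt ((le_max_right _ _).trans_lt hu)
  · rw [← hB k hk, Finset.sum_range_succ, Nat.sub_self, pow_zero]
    have h1 : a (k + 1) (n - k) = 1 := by
      have := ha1 k (n - k - 1) (by omega)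
      rwa [show n - k - 1 + 1 = n - k by omega] at this
    rw [h1, remainderTerm, Finset.mul_sum, Finset.mul_sum, add_comm]
    congr 1
    · ring
    · refine Finset.sum_congr rfl fun j hj => ?_
      have : n - k - j = (n - k - 1 - j) + 1 := by simp at hj; omega
      rw [this, pow_succ]
      ring

/-! ### Return to the original variables -/

/-- With `z = μ 0` the right-hand side of the Dyson equation is a row of the bordered matrix applied
to `μ`, cut off where the staircase condition makes the entries vanish. -/
lemma IsStaircase.sum_bordered {n : ℕ} {S : Matrix (Fin n) (Fin n) ℝ} (hS : IsStaircase S)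
    (k : Fin n) (μ : ℕ → ℂ) :
    ∑ j ∈ Finset.range (n - k + 1), (bordered S (k + 1) j : ℂ) * μ j =
      μ 0 + ∑ j : Fin n, (S k j : ℂ) * μ (j + 1) := by
  have h1 : ∑ j : Fin n, (S k j : ℂ) * μ (j + 1) =
      ∑ j ∈ Finset.range n, (bordered S (k + 1) (j + 1) : ℂ) * μ (j + 1) := by
    rw [← Fin.sum_univ_eq_sum_range (fun j => (bordered S (k + 1) (j + 1) : ℂ) * μ (j + 1))]
    refine Finset.sum_congr rfl fun j _ => ?_
    simp [bordered]
  rw [h1, Finset.sum_range_succ', add_comm]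
  congr 1
  · simp [bordered]
  · refine Finset.sum_subset (by intro j; simp; omega) fun j hj hj' => ?_
    simp only [Finset.mem_range] at hj hj'
    rw [bordered, dif_pos ⟨k.2, hj⟩, hS.zero_below _ _ (by simp only; omega)]
    simp

/-- The branch of `(-z ^ 2) ^ (1 / (n + 1))` used as the small parameter. -/
noncomputable def smallParam (n : ℕ) (z : ℍ) : ℂ :=
  Complex.exp ((2 * Complex.log z - Real.pi * Complex.I) / ((n : ℂ) + 1))

lemma smallParam_ne_zero (n : ℕ) (z : ℍ) : smallParam n z ≠ 0 := Complex.exp_ne_zero _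

lemma smallParam_pow (n : ℕ) (z : ℍ) : smallParam n z ^ (n + 1) = -(z : ℂ) ^ 2 := by
  have hn : (n : ℂ) + 1 ≠ 0 := Nat.cast_add_one_ne_zero n
  rw [smallParam, ← Complex.exp_nat_mul]
  push_cast
  rw [mul_div_cancel₀ _ hn, Complex.exp_sub, Complex.exp_pi_mul_I, two_mul, Complex.exp_add,
    Complex.exp_log z.ne_zero]
  ring

lemma tendsto_smallParam (n : ℕ) :
    Tendsto (smallParam n) (comap (fun z : ℍ => (z : ℂ)) (𝓝 0)) (𝓝 0) := by
  rw [tendsto_zero_iff_norm_tendsto_zero]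
  have h1 : Tendsto (fun z : ℍ => ‖(z : ℂ)‖) (comap (fun z : ℍ => (z : ℂ)) (𝓝 0)) (𝓝[>] 0) := by
    refine tendsto_nhdsWithin_iff.2 ⟨?_, Eventually.of_forall fun z => norm_pos_iff.2 z.ne_zero⟩
    simpa using (tendsto_comap (f := fun z : ℍ => (z : ℂ)) (x := 𝓝 0)).norm
  have h2 := (Real.tendsto_log_nhdsGT_zero.comp h1).const_mul_atBot
    (show (0 : ℝ) < 2 / ((n : ℝ) + 1) by positivity)
  refine (Real.tendsto_exp_atBot.comp h2).congr fun z => ?_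
  have h3 : (2 * Complex.log z - Real.pi * Complex.I) / ((n : ℂ) + 1) =
      ((1 / ((n : ℝ) + 1) : ℝ) : ℂ) * (2 * Complex.log z - Real.pi * Complex.I) := by
    push_cast; ring
  rw [smallParam, Complex.norm_exp, h3, Complex.re_ofReal_mul]
  simp [Complex.log_re]
  ring

lemma mul_inv_smallParam_pow (n : ℕ) (z : ℍ) (k : ℕ) :
    (z : ℂ) * (smallParam n z ^ k)⁻¹ = Complex.exp (Complex.log z -
      ((k / ((n : ℝ) + 1) : ℝ) : ℂ) * (2 * Complex.log z - Real.pi * Complex.I)) := by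
  rw [Complex.exp_sub, Complex.exp_log z.ne_zero, div_eq_mul_inv, smallParam,
    ← Complex.exp_nat_mul]
  congr 3
  push_cast
  ring

lemma mul_inv_smallParam_pow_mul_cpow {n : ℕ} (z : ℍ) (k : Fin n) :
    (z : ℂ) * (smallParam n z ^ ((k : ℕ) + 1))⁻¹ * (z : ℂ) ^ ((-(vdeExponent n k) : ℝ) : ℂ) =
      Complex.exp (Complex.I * (Real.pi * ((k : ℂ) + 1) / ((n : ℂ) + 1))) := by
  rw [mul_inv_smallParam_pow, Complex.cpow_def_of_ne_zero z.ne_zero, ← Complex.exp_add, vdeExponent]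
  congr 1
  push_cast
  ring

lemma sin_le_sin_of_mem_Icc {δ φ : ℝ} (hδ : 0 ≤ δ) (h1 : δ ≤ φ) (h2 : φ ≤ Real.pi - δ) :
    Real.sin δ ≤ Real.sin φ := by
  rcases le_total φ (Real.pi / 2) with h | h
  · exact Real.sin_le_sin_of_le_of_le_pi_div_two (by linarith [Real.pi_pos]) h h1
  · rw [← Real.sin_pi_sub φ]
    exact Real.sin_le_sin_of_le_of_le_pi_div_two (by linarith [Real.pi_pos]) (by linarith)
      (by linarith)

/-- The leading terms `z * ζ ^ (-k)` lie in a closed sector of `ℍ` independent of `z`, so they stay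
in `ℍ` after multiplication by a number close to `1`, even when `z` approaches `0` tangentially to
the real axis. -/
lemma im_mul_inv_smallParam_pow_mul_pos {n : ℕ} (z : ℍ) (k : Fin n) {u : ℂ}
    (hu : ‖u - 1‖ < Real.sin (Real.pi / ((n : ℝ) + 1))) :
    0 < ((z : ℂ) * (smallParam n z ^ ((k : ℕ) + 1))⁻¹ * u).im := by
  rw [mul_inv_smallParam_pow]
  set κ : ℝ := (((k : ℕ) + 1 : ℕ) : ℝ) / ((n : ℝ) + 1) with hκ
  set w : ℂ := Complex.log z - (κ : ℂ) * (2 * Complex.log z - Real.pi * Complex.I) with hw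
  set θ := Complex.arg z with hθ
  have him : w.im = θ - κ * (2 * θ - Real.pi) := by
    rw [hw, Complex.sub_im, Complex.im_ofReal_mul]
    simp [Complex.log_im, hθ]
  have hθ0 : 0 ≤ θ := Complex.arg_nonneg_iff.2 z.im_pos.le
  have hθπ : θ ≤ Real.pi := Complex.arg_le_pi _
  have hn : (0 : ℝ) < (n : ℝ) + 1 := by positivity
  set ν : ℝ := 1 / ((n : ℝ) + 1) with hν
  have hν0 : 0 < ν := by positivity
  have hκ1 : ν ≤ κ := by
    rw [hν, hκ]
    gcongr
    simp
  have hκ2 : ν ≤ 1 - κ := by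
    have : ((k : ℕ) : ℝ) + 1 ≤ n := by exact_mod_cast k.2
    rw [hν, hκ, le_sub_iff_add_le, ← add_div, div_le_one hn]
    push_cast
    linarith
  have hδ : Real.pi / ((n : ℝ) + 1) = ν * Real.pi := by rw [hν]; ring
  have hsin : Real.sin (ν * Real.pi) ≤ Real.sin w.im := by
    rw [him]
    refine sin_le_sin_of_mem_Icc (by positivity) ?_ ?_
    · nlinarith [mul_nonneg hθ0 (sub_nonneg.2 hκ2), mul_nonneg (sub_nonneg.2 hθπ) (sub_nonneg.2 hκ1)]
    · nlinarith [mul_nonneg hθ0 (sub_nonneg.2 hκ1), mul_nonneg (sub_nonneg.2 hθπ) (sub_nonneg.2 hκ2)]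
  rw [hδ] at hu
  have h1 : Complex.exp w * u = Complex.exp w + Complex.exp w * (u - 1) := by ring
  have h2 := neg_le_of_abs_le (Complex.abs_im_le_norm (Complex.exp w * (u - 1)))
  rw [norm_mul, Complex.norm_exp] at h2
  rw [h1, Complex.add_im, Complex.exp_im]
  have h3 := mul_lt_mul_of_pos_left (hu.trans_le hsin) (Real.exp_pos w.re)
  linarith

/-- For `z` near `0` the solution is `c k * z * ζ ^ (-k)` up to a factor close to `1`. The candidate
built from the scaled equations takes values in `ℍ`, so it is the solution by pointwise
uniqueness; no regularity of `m` in `z` enters. -/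
lemma IsStaircase.eventually_eq_leading_mul {n : ℕ} {S : Matrix (Fin n) (Fin n) ℝ}
    (hS : IsStaircase S) {t : ℝ} {c : ℕ → ℝ} (ht : 0 < t) (hc0 : c 0 = 1) (hc : ∀ k, 0 < c k)
    (h1 : ∀ i j, i + j + 1 = n → bordered S (i + 1) (j + 1) * (c (i + 1) * c (j + 1)) = 1)
    (h2 : ∀ i j, i + j = n → bordered S i j * (c i * c j) = t)
    {m : ℍ → Fin n → ℍ} (hm : IsVDESolution S m) (k : Fin n) {ε : ℝ} (hε : 0 < ε) :
    ∀ᶠ z : ℍ in comap (fun z : ℍ => (z : ℂ)) (𝓝 0), ∃ u : ℂ, ‖u - 1‖ < ε ∧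
      (m z k : ℂ) = c (k + 1) * ((z : ℂ) * (smallParam n z ^ ((k : ℕ) + 1))⁻¹ * u) := by
  have hsin : 0 < Real.sin (Real.pi / ((n : ℝ) + 1)) := by
    have hn : (1 : ℝ) ≤ n := by exact_mod_cast (Nat.zero_le _).trans_lt k.2
    exact Real.sin_pos_of_pos_of_lt_pi (by have := Real.pi_pos; positivity)
      (div_lt_self Real.pi_pos (by linarith))
  have hev := eventually_exists_scaled_solution (n := n)
    (a := fun i j => ((bordered S i j * (c i * c j) : ℝ) : ℂ)) (t := (t : ℂ))
    (Complex.ofReal_ne_zero.2 ht.ne') (fun i j h => by rw [h1 i j h, Complex.ofReal_one])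
    (fun i j h => by rw [h2 i j h]) (lt_min hε hsin)
  filter_upwards [(tendsto_smallParam n).eventually hev] with z hz
  obtain ⟨u, hu0, hu, hsum⟩ := hz
  refine ⟨u (k + 1), (hu k k.2).trans_le (min_le_left _ _), ?_⟩
  set ζ := smallParam n z with hζ
  have hζ0 : ζ ≠ 0 := smallParam_ne_zero n z
  set μ : ℕ → ℂ := fun i => c i * ((z : ℂ) * (ζ ^ i)⁻¹ * u i) with hμ
  have him : ∀ i : Fin n, 0 < (μ (i + 1)).im := fun i => by
    simp only [hμ]
    rw [Complex.im_ofReal_mul]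
    exact mul_pos (hc _)
      (im_mul_inv_smallParam_pow_mul_pos z i ((hu i i.2).trans_le (min_le_right _ _)))
  let w : Fin n → ℍ := fun i => ⟨μ (i + 1), him i⟩
  have hw : dysonMap S hS.nonneg z w = w := by
    rw [dysonMap_eq_iff]
    intro i
    change -1 / μ (i + 1) = (z : ℂ) + ∑ j : Fin n, (S i j : ℂ) * μ (j + 1)
    have hμ0 : μ 0 = z := by simp [hμ, hc0, hu0]
    have hne : μ (i + 1) ≠ 0 := fun h => by simpa [h] using him i
    conv_rhs => rw [← hμ0]
    rw [← hS.sum_bordered i μ, div_eq_iff hne, ← hsum i i.2, Finset.sum_mul, ← Finset.sum_neg_distrib]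
    refine Finset.sum_congr rfl fun j hj => ?_
    have hexp : n + 1 = (n - i - j) + ((i + 1) + j) := by simp at hj; omega
    have hz2 := smallParam_pow n z
    rw [← hζ, hexp, pow_add ζ, pow_add ζ ((i : ℕ) + 1) j] at hz2
    have hi := pow_ne_zero ((i : ℕ) + 1) hζ0
    have hj' := pow_ne_zero j hζ0
    simp only [hμ]
    -- This is `-z ^ 2 = ζ ^ (n + 1)`, split according to the two powers of `ζ` in `μ (i + 1)`
    -- and `μ j`.
    have hzz : ζ ^ (n - i - j) = -((z : ℂ) * (ζ ^ ((i : ℕ) + 1))⁻¹) * ((z : ℂ) * (ζ ^ j)⁻¹) := by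
      field_simp
      linear_combination hz2
    rw [hzz]
    push_cast
    ring
  have := (existsUnique_dysonMap_eq S hS.nonneg z).unique
    ((dysonMap_eq_iff S hS.nonneg z _).2 (hm z)) hw
  rw [this]

theorem theorem1p3 (n : ℕ) (S : Matrix (Fin n) (Fin n) ℝ) (hS : IsStaircase S) :
    (∃! m : ℍ → Fin n → ℍ, IsVDESolution S m) ∧
    ∃ c : Fin n → ℝ, (∀ k, 0 < c k) ∧
      ∀ m : ℍ → Fin n → ℍ, IsVDESolution S m → ∀ k : Fin n,
        Tendsto (fun z : ℍ => (m z k : ℂ) * (z : ℂ) ^ ((-(vdeExponent n k) : ℝ) : ℂ))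
          (comap (fun z : ℍ => (z : ℂ)) (𝓝 0))
          (𝓝 ((c k : ℂ) *
            Complex.exp (Complex.I * (Real.pi * ((k : ℂ) + 1) / ((n : ℂ) + 1))))) := by
  refine ⟨existsUnique_isVDESolution S hS.nonneg, ?_⟩
  obtain ⟨t, c, ht, hc0, hc, h1, h2⟩ := hS.exists_scaling
  refine ⟨fun k => c (k + 1), fun k => hc _, fun m hm k => ?_⟩
  rw [Metric.tendsto_nhds]
  intro ε hε
  filter_upwards [hS.eventually_eq_leading_mul ht hc0 hc h1 h2 hm k (div_pos hε (hc (k + 1)))]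
    with z ⟨u, hu, hmz⟩
  set e := Complex.exp (Complex.I * (Real.pi * ((k : ℂ) + 1) / ((n : ℂ) + 1))) with he
  have hnorm : ‖e‖ = 1 := by
    rw [he, Complex.norm_exp]
    have : Complex.I * (Real.pi * ((k : ℂ) + 1) / ((n : ℂ) + 1)) =
        ((Real.pi * ((k : ℝ) + 1) / ((n : ℝ) + 1) : ℝ) : ℂ) * Complex.I := by push_cast; ring
    rw [this, Complex.re_ofReal_mul]
    simp
  have hdiff : (m z k : ℂ) * (z : ℂ) ^ ((-(vdeExponent n k) : ℝ) : ℂ) - c (k + 1) * e =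
      c (k + 1) * e * (u - 1) := by
    rw [hmz, he, ← mul_inv_smallParam_pow_mul_cpow z k]
    ring
  rw [dist_eq_norm, hdiff, norm_mul, norm_mul, hnorm, mul_one, Complex.norm_real,
    Real.norm_of_nonneg (hc _).le]
  rwa [lt_div_iff₀' (hc _)] at hu
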